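/- Let $B_m$ ($m\geq 0$) be the Bernoulli numbers, defined by $\frac{t}{e^t-1}=\sum_{m=0}^{\infty}B_m\frac{t^m}{m!}$. For a sequence $(c_k)_{k\geq 0}$ and an integer $n\geq 0$ let $H_n(c_k)=\det_{0\leq i,j\leq n}(c_{i+j})$ denote the Hankel determinant, of size $(n+1)\times(n+1)$, of the sequence, and let $\mathcal{H}_n=\sum_{j=1}^{n}\frac{1}{j}$ be the $n$th harmonic number. Then for all $n\geq 1$, $$H_n\big((2^{2k}-1)B_{2k}\big)=\frac{(-1)^n}{n!\,(n+1)!}\cdot\mathcal{H}_n\cdot H_n\big((2^{2k+2}-1)B_{2k+2}\big).$$ -/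

import Mathlib

open scoped Nat

/-- The Hankel determinant `H_n(c) = det (c_{i+j})_{0 ≤ i, j ≤ n}`, of size `n + 1`. -/
def hankelDet {R : Type*} [CommRing R] (n : ℕ) (c : ℕ → R) : R :=
  (Matrix.of fun i j : Fin (n + 1) => c ((i : ℕ) + (j : ℕ))).det

/-! Let `L` be the functional with moments `(2^(2k+2) - 1) B_{2k+2}` and `M` the one with moments
`(2^(2k) - 1) B_{2k}`, so that `M(X q) = L(q)`. Both determinants are reduced to the same smaller
one by the monic orthogonal polynomials `p_n` of `L`. The Hankel matrix of `L` sends the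
coefficients of `p_n` to a multiple of the last basis vector, with factor `L(X^n p_n) = n!^3
(n+1)!/2`. That of `M` sends them to `M(p_n)` times the first basis vector, since `M(X^i p_n) =
L(X^(i-1) p_n) = 0` for `1 ≤ i ≤ n`. By Cramer's rule each determinant is, up to sign, its factor
times the Hankel determinant of `L` of index `n - 1`. The harmonic number enters through `M(p_n) =
n!^2 H_n/2`, which follows from the three-term recurrence. Orthogonality comes from the values of
`L` on central factorials together with a hypergeometric expansion of `p_n`. -/

open Polynomial in
/-- The linear functional on polynomials with moments `c`. -/
noncomputable def momentFunctional (c : ℕ → ℚ) : ℚ[X] →ₗ[ℚ] ℚ :=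
  Polynomial.lsum fun k => c k • LinearMap.id

namespace momentFunctional

open Polynomial

theorem eq_sum (c : ℕ → ℚ) (p : ℚ[X]) {n : ℕ} (hp : p.natDegree < n) :
    momentFunctional c p = ∑ j ∈ Finset.range n, c j * p.coeff j := by
  simp only [momentFunctional, Polynomial.lsum_apply]
  rw [Polynomial.sum_over_range' _ (by simp) n hp]
  simp

@[simp]
theorem apply_X_pow (c : ℕ → ℚ) (k : ℕ) : momentFunctional c (X ^ k) = c k := by
  rw [eq_sum c _ (n := k + 1) (by simp)]
  simp [coeff_X_pow]

theorem apply_X_mul (c : ℕ → ℚ) (p : ℚ[X]) :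
    momentFunctional c (X * p) = momentFunctional (fun k => c (k + 1)) p := by
  induction p using Polynomial.induction_on' with
  | add p q hp hq => rw [mul_add, map_add, map_add, hp, hq]
  | monomial n a =>
    rw [← C_mul_X_pow_eq_monomial, ← smul_eq_C_mul, mul_smul_comm, ← pow_succ', map_smul,
      map_smul, apply_X_pow, apply_X_pow]

theorem apply_X_pow_mul (c : ℕ → ℚ) (i : ℕ) (p : ℚ[X]) :
    momentFunctional c (X ^ i * p) = momentFunctional (fun k => c (i + k)) p := by
  induction i generalizing c with
  | zero => simp
  | succ i ih =>
    rw [pow_succ', mul_assoc, apply_X_mul, ih]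
    simp only [add_right_comm]

theorem apply_expand (c : ℕ → ℚ) (p : ℚ[X]) :
    momentFunctional c (expand ℚ 2 p) = momentFunctional (fun k => c (2 * k)) p := by
  induction p using Polynomial.induction_on' with
  | add p q hp hq => rw [map_add, map_add, map_add, hp, hq]
  | monomial n a =>
    rw [← C_mul_X_pow_eq_monomial, map_mul, map_pow, expand_C, expand_X, ← pow_mul,
      ← smul_eq_C_mul, ← smul_eq_C_mul, map_smul, map_smul, apply_X_pow, apply_X_pow]

end momentFunctional

/-! ### Hankel determinants by Cramer's rule -/

section Hankel

open Polynomial Matrix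

/-- If the Hankel matrix of `c` sends the coefficients of a monic polynomial `p` of degree `n` to a
multiple of a basis vector, its determinant is a multiple of a minor. -/
theorem hankelDet_eq_of_moments (n : ℕ) (c : ℕ → ℚ) (p : ℚ[X]) (hdeg : p.natDegree ≤ n)
    (hlead : p.coeff n = 1) (r : Fin (n + 1)) (h : ℚ)
    (hp : ∀ i : Fin (n + 1), momentFunctional c (X ^ (i : ℕ) * p) = if i = r then h else 0) :
    hankelDet n c = (-1) ^ ((r : ℕ) + n) * h *
      (Matrix.of fun i j : Fin n => c ((r.succAbove i : ℕ) + (j : ℕ))).det := by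
  set A : Matrix (Fin (n + 1)) (Fin (n + 1)) ℚ := Matrix.of fun i j => c ((i : ℕ) + (j : ℕ)) with hA
  let v : Fin (n + 1) → ℚ := fun j => p.coeff j
  have hv : A *ᵥ v = Pi.single r h := by
    ext i
    rw [Pi.single_apply, ← hp i, momentFunctional.apply_X_pow_mul,
      momentFunctional.eq_sum _ _ (Nat.lt_succ_of_le hdeg), Finset.sum_range]
    rfl
  -- Cramer's rule without assuming `A` invertible; the last coordinate of `v` is 1, so that row
  -- isolates `A.det`.
  have key : A.det • v = A.adjugate *ᵥ Pi.single r h := by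
    rw [← hv, mulVec_mulVec, adjugate_mul, smul_mulVec, one_mulVec]
  have := congrFun key (Fin.last n)
  rw [mulVec_single] at this
  simp only [Pi.smul_apply, smul_eq_mul, v, Fin.val_last, hlead, mul_one,
    adjugate_fin_succ_eq_det_submatrix, MulOpposite.smul_eq_mul_unop, MulOpposite.unop_op,
    col_apply] at this
  rw [show hankelDet n c = A.det from rfl, this, Fin.succAbove_last]
  have e : A.submatrix r.succAbove Fin.castSucc
      = Matrix.of fun i j : Fin n => c ((r.succAbove i : ℕ) + (j : ℕ)) := by
    ext i j; simp [hA]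
  rw [e]; ring

end Hankel

/-! ### Genocchi moments and their values on central factorials -/

section Genocchi

open Polynomial

/-- Subtract `t/(e^t - 1)` from `2t/(e^(2t) - 1)`, using `e^(2t) - 1 = (e^t - 1)(e^t + 1)`; the
factor `e^t - 1` cancels. -/
theorem genocchi_powerSeries_mul :
    (PowerSeries.rescale 2 (bernoulliPowerSeries ℚ) - bernoulliPowerSeries ℚ) *
      (PowerSeries.exp ℚ + 1) = -PowerSeries.X := by
  have h1 := bernoulliPowerSeries_mul_exp_sub_one ℚ
  have h2 := congrArg (PowerSeries.rescale (2 : ℚ)) h1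
  have hE : PowerSeries.rescale (2 : ℚ) (PowerSeries.exp ℚ) = PowerSeries.exp ℚ ^ 2 := by
    rw [PowerSeries.exp_pow_eq_rescale_exp]; norm_num
  rw [map_mul, map_sub, map_one, hE, PowerSeries.rescale_X] at h2
  have hne : PowerSeries.exp ℚ - 1 ≠ 0 := by
    intro h
    rw [h, mul_zero] at h1
    exact PowerSeries.X_ne_zero h1.symm
  refine mul_right_cancel₀ hne ?_
  have h3 : (PowerSeries.C (2 : ℚ)) = 2 := map_ofNat _ 2
  rw [h3] at h2
  linear_combination h2 - (PowerSeries.exp ℚ + 1) * h1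

/-- The moments `(2 ^ m - 1) * B_m`, that is, the Genocchi numbers divided by `-2`. -/
def genocchiMoment (m : ℕ) : ℚ := (2 ^ m - 1) * _root_.bernoulli m

theorem sum_choose_mul_genocchiMoment (m : ℕ) :
    ∑ j ∈ Finset.range (m + 1), (m.choose j : ℚ) * genocchiMoment j + genocchiMoment m =
      if m = 1 then -1 else 0 := by
  have h := congrArg (fun s => (m ! : ℚ) * PowerSeries.coeff m s) genocchi_powerSeries_mul
  simp only [mul_add, mul_one, map_add, map_neg, PowerSeries.coeff_X] at h
  have hm : (m ! : ℚ) ≠ 0 := by positivity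
  have e2 : (m ! : ℚ) * PowerSeries.coeff m
      (PowerSeries.rescale 2 (bernoulliPowerSeries ℚ) - bernoulliPowerSeries ℚ) =
      genocchiMoment m := by
    simp only [map_sub, PowerSeries.coeff_rescale, bernoulliPowerSeries, PowerSeries.coeff_mk,
      genocchiMoment, Algebra.algebraMap_self, RingHom.id_apply]
    field_simp
  rw [e2, PowerSeries.coeff_mul, Finset.Nat.sum_antidiagonal_eq_sum_range_succ_mk,
    Finset.mul_sum] at h
  convert h using 2
  · refine Finset.sum_congr rfl fun j hj => ?_
    have hj' : j ≤ m := Nat.lt_succ_iff.mp (Finset.mem_range.mp hj)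
    have h3 : (j ! : ℚ) ≠ 0 := by positivity
    have h4 : ((m - j)! : ℚ) ≠ 0 := by positivity
    simp only [map_sub, PowerSeries.coeff_rescale, bernoulliPowerSeries, PowerSeries.coeff_mk,
      genocchiMoment, Algebra.algebraMap_self, RingHom.id_apply, PowerSeries.coeff_exp,
      Nat.cast_choose ℚ hj']
    field_simp
  · split_ifs with h1 <;> simp [h1]

/-- Umbral form of the generating function identity: multiplication by `e^t` becomes the shift `X ↦
X + 1`, and `-t` becomes minus the derivative at 0. -/
theorem momentFunctional_genocchi_comp (p : ℚ[X]) :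
    momentFunctional genocchiMoment (p.comp (X + 1)) + momentFunctional genocchiMoment p =
      -p.derivative.eval 0 := by
  induction p using Polynomial.induction_on' with
  | add p q hp hq =>
    simp only [add_comp, map_add, eval_add]
    linear_combination hp + hq
  | monomial m a =>
    rw [← C_mul_X_pow_eq_monomial, mul_comp, C_comp, X_pow_comp, ← smul_eq_C_mul,
      ← smul_eq_C_mul, map_smul, map_smul, derivative_smul, add_pow, map_sum]
    have e : ∀ j ∈ Finset.range (m + 1), momentFunctional genocchiMoment
        (X ^ j * 1 ^ (m - j) * (m.choose j : ℚ[X])) = m.choose j * genocchiMoment j := by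
      intro j _
      rw [one_pow, mul_one, ← C_eq_natCast, mul_comm, ← smul_eq_C_mul, map_smul,
        momentFunctional.apply_X_pow, smul_eq_mul]
    rw [Finset.sum_congr rfl e, momentFunctional.apply_X_pow, ← smul_add,
      sum_choose_mul_genocchiMoment]
    rcases m with _ | _ | m <;> simp

/-- `∏ j < k, (X - j ^ 2)`. -/
noncomputable def centralFactorial (k : ℕ) : ℚ[X] := ∏ j ∈ Finset.range k, (X - C ((j : ℚ) ^ 2))

theorem centralFactorial_succ (k : ℕ) :
    centralFactorial (k + 1) = centralFactorial k * (X - C ((k : ℚ) ^ 2)) :=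
  Finset.prod_range_succ _ _

/-- `(X + k - 1) ⋯ (X - k)`. -/
noncomputable def shiftedFactorial (k : ℕ) : ℚ[X] :=
  ∏ j ∈ Finset.range k, ((X + C (j : ℚ)) * (X - C ((j : ℚ) + 1)))

theorem X_mul_shiftedFactorial (k : ℕ) :
    X * shiftedFactorial k = (X - C (k : ℚ)) * expand ℚ 2 (centralFactorial k) := by
  induction k with
  | zero => simp [shiftedFactorial, centralFactorial]
  | succ k ih =>
    rw [shiftedFactorial, Finset.prod_range_succ, ← shiftedFactorial, centralFactorial_succ,
      ← mul_assoc, ih]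
    simp only [map_mul, map_sub, expand_X, expand_C, map_pow, Nat.cast_succ, map_add, map_one]
    ring

/-- The shift by 1 only trades the end factor `X - k` for `X + k`, so a shifted factorial and its
translate share the same even part. -/
theorem X_mul_shiftedFactorial_comp (k : ℕ) :
    X * (shiftedFactorial k).comp (X + 1) =
      (X + C (k : ℚ)) * expand ℚ 2 (centralFactorial k) := by
  induction k with
  | zero => simp [shiftedFactorial, centralFactorial]
  | succ k ih =>
    rw [shiftedFactorial, Finset.prod_range_succ, ← shiftedFactorial, centralFactorial_succ,
      mul_comp, ← mul_assoc, ih]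
    simp only [map_mul, map_sub, expand_X, expand_C, map_pow, Nat.cast_succ, map_add, map_one,
      mul_comp, add_comp, sub_comp, X_comp, C_comp, one_comp]
    ring

/-- The numbers `(2 ^ (2 k + 2) - 1) * B_{2 k + 2}`. -/
abbrev evenMoment (k : ℕ) : ℚ := genocchiMoment (2 * (k + 1))

theorem momentFunctional_centralFactorial_succ (k : ℕ) :
    momentFunctional evenMoment (centralFactorial (k + 1)) =
      -((k : ℚ) + 1) ^ 2 * momentFunctional evenMoment (centralFactorial k) := by
  have hL (p : ℚ[X]) : momentFunctional evenMoment p =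
      momentFunctional genocchiMoment (X ^ 2 * expand ℚ 2 p) := by
    rw [show (X ^ 2 : ℚ[X]) = expand ℚ 2 X by rw [expand_X], ← map_mul,
      momentFunctional.apply_expand, momentFunctional.apply_X_mul]
  -- The factor `X^2` kills the derivative at 0. Adding the translate gives an even polynomial
  -- because `(X-1)^2 (X-k) + (X+1)^2 (X+k) = 2X((X^2 - k^2) + (k+1)^2)`.
  have h := momentFunctional_genocchi_comp (shiftedFactorial k * (X ^ 2 * (X - 1) ^ 2))
  have hd : (derivative (shiftedFactorial k * (X ^ 2 * (X - 1) ^ 2))).eval 0 = 0 := by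
    simp [derivative_mul, derivative_pow]
  have hs : (shiftedFactorial k * (X ^ 2 * (X - 1) ^ 2)).comp (X + 1) +
      shiftedFactorial k * (X ^ 2 * (X - 1) ^ 2) =
      (2 : ℚ) • (X ^ 2 * expand ℚ 2 (centralFactorial (k + 1)) +
        ((k : ℚ) + 1) ^ 2 • (X ^ 2 * expand ℚ 2 (centralFactorial k))) := by
    have h1 := X_mul_shiftedFactorial k
    have h2 := X_mul_shiftedFactorial_comp k
    simp only [centralFactorial_succ, smul_eq_C_mul, map_mul, map_sub, expand_X, expand_C, map_pow,
      map_add, map_one, mul_comp, sub_comp, X_comp, one_comp, pow_comp, C_ofNat]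
    linear_combination X * (X - 1) ^ 2 * h1 + X * (X + 1) ^ 2 * h2
  rw [← map_add, hs, hd, map_smul, map_add, map_smul, ← hL, ← hL] at h
  simp only [smul_eq_mul] at h
  linarith

theorem momentFunctional_centralFactorial (k : ℕ) :
    momentFunctional evenMoment (centralFactorial k) = (-1) ^ k * (k ! : ℚ) ^ 2 / 2 := by
  induction k with
  | zero =>
    have := momentFunctional.apply_X_pow evenMoment 0
    rw [pow_zero] at this
    rw [centralFactorial, Finset.prod_range_zero, this]
    norm_num [evenMoment, genocchiMoment, bernoulli_two]
  | succ k ih =>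
    rw [momentFunctional_centralFactorial_succ, ih, Nat.factorial_succ]
    push_cast
    ring

end Genocchi

/-! ### Orthogonal polynomials: recurrence, hypergeometric form, moments -/

section OrthogonalPolynomials

open Polynomial

/-- The monic orthogonal polynomials for the moments `evenMoment`: continuous dual Hahn polynomials
with parameters `(0, 1, 1)` in the variable `-X`. -/
noncomputable def dualHahn : ℕ → ℚ[X]
  | 0 => 1
  | 1 => X + 1
  | n + 2 => (X + C (((n : ℚ) + 2) * (2 * n + 3))) * dualHahn (n + 1) -
      C (((n : ℚ) + 1) ^ 3 * (n + 2)) * dualHahn n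

theorem dualHahn_add_two (n : ℕ) :
    dualHahn (n + 2) = (X + C (((n : ℚ) + 2) * (2 * n + 3))) * dualHahn (n + 1) -
      C (((n : ℚ) + 1) ^ 3 * (n + 2)) * dualHahn n := by
  rw [dualHahn]

theorem dualHahn_monic_natDegree (n : ℕ) :
    (dualHahn n).natDegree ≤ n ∧ (dualHahn n).coeff n = 1 := by
  induction n using Nat.twoStepInduction with
  | zero => simp [dualHahn]
  | one =>
    refine ⟨?_, by simp [dualHahn, coeff_one]⟩
    rw [dualHahn]; compute_degree
  | more n h0 h1 =>
    have hz : (dualHahn n).coeff (n + 2) = 0 := coeff_eq_zero_of_natDegree_lt (by omega)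
    have hz' : (dualHahn (n + 1)).coeff (n + 2) = 0 := coeff_eq_zero_of_natDegree_lt (by omega)
    rw [dualHahn_add_two]
    constructor
    · refine (natDegree_sub_le _ _).trans (max_le ?_ ?_)
      · refine natDegree_mul_le.trans ?_
        rw [natDegree_X_add_C]; omega
      · refine (natDegree_C_mul_le _ _).trans (by omega)
    · rw [coeff_sub, add_mul, coeff_add, coeff_C_mul, coeff_C_mul, coeff_X_mul, hz, hz', h1.2]
      ring

/-- The summands `(∏ j < k, (X - j ^ 2)) / k! ^ 2` of the hypergeometric form. -/
noncomputable def scaledCentralFactorial (k : ℕ) : ℚ[X] :=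
  C (((k ! : ℚ) ^ 2)⁻¹) * centralFactorial k

theorem X_mul_scaledCentralFactorial (k : ℕ) :
    X * scaledCentralFactorial k = C (((k : ℚ) + 1) ^ 2) * scaledCentralFactorial (k + 1) +
      C ((k : ℚ) ^ 2) * scaledCentralFactorial k := by
  have h : ((k : ℚ) + 1) ^ 2 * (((k + 1)! : ℚ) ^ 2)⁻¹ = ((k ! : ℚ) ^ 2)⁻¹ := by
    rw [Nat.factorial_succ]; push_cast; field_simp
  simp only [scaledCentralFactorial]
  rw [← mul_assoc (C (((k : ℚ) + 1) ^ 2)), ← C_mul, h, centralFactorial_succ]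
  ring

/-- The hypergeometric sum `∑ k, n.choose k * (∏ j < k, (X - j ^ 2)) / k! ^ 2`. -/
noncomputable def hypergeometricSum (n : ℕ) : ℚ[X] :=
  ∑ k ∈ Finset.range (n + 1), C (n.choose k : ℚ) * scaledCentralFactorial k

theorem hypergeometricSum_eq {n N : ℕ} (h : n ≤ N) :
    hypergeometricSum n =
      ∑ k ∈ Finset.range (N + 1), C (n.choose k : ℚ) * scaledCentralFactorial k := by
  refine Finset.sum_subset (Finset.range_subset_range.mpr (by omega)) fun k _ hk => ?_
  rw [Nat.choose_eq_zero_of_lt (by simpa using hk)]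
  simp

theorem choose_recurrence (n j : ℕ) :
    ((n : ℚ) + 2) ^ 2 * (n + 2).choose (j + 1) =
      ((j : ℚ) + 1) ^ 2 * (n + 1).choose j + ((j : ℚ) + 1) ^ 2 * (n + 1).choose (j + 1) +
        (n + 2) * (2 * n + 3) * (n + 1).choose (j + 1) - (n + 1) * (n + 2) * n.choose (j + 1) := by
  have h1 : (((n + 2).choose (j + 1) : ℕ) : ℚ) = (n + 1).choose j + (n + 1).choose (j + 1) := by
    exact_mod_cast Nat.choose_succ_succ' (n + 1) j
  have h2 : (((n + 1).choose (j + 1) : ℕ) : ℚ) = n.choose j + n.choose (j + 1) := by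
    exact_mod_cast Nat.choose_succ_succ' n j
  have h3 : ((n : ℚ) + 2) * (n + 1).choose j = (n + 2).choose (j + 1) * (j + 1) := by
    exact_mod_cast Nat.add_one_mul_choose_eq (n + 1) j
  have h4 : ((n : ℚ) + 1) * n.choose j = (n + 1).choose (j + 1) * (j + 1) := by
    exact_mod_cast Nat.add_one_mul_choose_eq n j
  rw [h1] at h3 ⊢
  rw [h2] at h3 h4 ⊢
  linear_combination ((j : ℚ) + 1) * h3 + ((n : ℚ) + 2) * (h3 - h4)

/-- This is the recurrence of `dualHahn` divided by `(n+1)!^2`. It is checked coefficientwise in the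
basis `scaledCentralFactorial`, on which `X` acts by two terms. -/
theorem hypergeometricSum_add_two (n : ℕ) :
    C (((n : ℚ) + 2) ^ 2) * hypergeometricSum (n + 2) =
      (X + C (((n : ℚ) + 2) * (2 * n + 3))) * hypergeometricSum (n + 1) -
        C (((n : ℚ) + 1) * (n + 2)) * hypergeometricSum n := by
  have hX : X * hypergeometricSum (n + 1) = ∑ j ∈ Finset.range (n + 2),
      C (((j : ℚ) + 1) ^ 2 * (n + 1).choose j + ((j : ℚ) + 1) ^ 2 * (n + 1).choose (j + 1)) *
        scaledCentralFactorial (j + 1) := by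
    have e : X * hypergeometricSum (n + 1) =
        ∑ j ∈ Finset.range (n + 2), C (((j : ℚ) + 1) ^ 2 * (n + 1).choose j) *
          scaledCentralFactorial (j + 1) +
        ∑ j ∈ Finset.range (n + 3), C ((j : ℚ) ^ 2 * (n + 1).choose j) *
          scaledCentralFactorial j := by
      -- The extra top term vanishes; it is there so that splitting off `j = 0` later leaves two
      -- sums of equal length.
      rw [Finset.sum_range_succ _ (n + 2), Nat.choose_eq_zero_of_lt (by omega : n + 1 < n + 2),
        hypergeometricSum, Finset.mul_sum]
      simp only [Nat.cast_zero, mul_zero, map_zero, zero_mul, add_zero]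
      rw [← Finset.sum_add_distrib]
      refine Finset.sum_congr rfl fun j _ => ?_
      rw [mul_left_comm, X_mul_scaledCentralFactorial, C_mul, C_mul]
      ring
    rw [e, Finset.sum_range_succ' _ (n + 2)]
    simp only [Nat.cast_zero, ne_eq, OfNat.ofNat_ne_zero, not_false_eq_true, zero_pow, zero_mul,
      map_zero, add_zero]
    rw [← Finset.sum_add_distrib]
    refine Finset.sum_congr rfl fun j _ => ?_
    push_cast
    rw [C_add]
    ring
  rw [add_mul, hX, hypergeometricSum_eq (show n + 1 ≤ n + 2 by omega),
    hypergeometricSum_eq (show n ≤ n + 2 by omega), hypergeometricSum,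
    Finset.sum_range_succ' _ (n + 2), Finset.sum_range_succ' _ (n + 2),
    Finset.sum_range_succ' _ (n + 2)]
  simp only [mul_add, Finset.mul_sum]
  have e : ∑ j ∈ Finset.range (n + 2), C (((n : ℚ) + 2) ^ 2) *
      (C ((n + 2).choose (j + 1) : ℚ) * scaledCentralFactorial (j + 1)) =
      ∑ j ∈ Finset.range (n + 2), C (((j : ℚ) + 1) ^ 2 * (n + 1).choose j +
        ((j : ℚ) + 1) ^ 2 * (n + 1).choose (j + 1)) * scaledCentralFactorial (j + 1) +
      ∑ j ∈ Finset.range (n + 2), C (((n : ℚ) + 2) * (2 * n + 3)) *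
        (C ((n + 1).choose (j + 1) : ℚ) * scaledCentralFactorial (j + 1)) -
      ∑ j ∈ Finset.range (n + 2), C (((n : ℚ) + 1) * (n + 2)) *
        (C (n.choose (j + 1) : ℚ) * scaledCentralFactorial (j + 1)) := by
    rw [← Finset.sum_add_distrib, ← Finset.sum_sub_distrib]
    refine Finset.sum_congr rfl fun j _ => ?_
    rw [← mul_assoc, ← C_mul, choose_recurrence]
    simp only [C_add, C_sub, C_mul]
    ring
  rw [e]
  simp only [Nat.choose_zero_right, Nat.cast_one, map_one, one_mul]
  have e0 : C (((n : ℚ) + 2) ^ 2) =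
      C (((n : ℚ) + 2) * (2 * n + 3)) - C (((n : ℚ) + 1) * (n + 2)) := by
    rw [← C_sub]; exact congrArg C (by ring)
  rw [e0]
  ring_nf

theorem dualHahn_eq (n : ℕ) : dualHahn n = C ((n ! : ℚ) ^ 2) * hypergeometricSum n := by
  induction n using Nat.twoStepInduction with
  | zero => simp [dualHahn, hypergeometricSum, scaledCentralFactorial, centralFactorial]
  | one =>
    simp [dualHahn, hypergeometricSum, scaledCentralFactorial, centralFactorial,
      Finset.sum_range_succ, add_comm]
  | more n h0 h1 =>
    have e2 : ((n + 2)! : ℚ) = (n + 2) * (n + 1)! := by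
      rw [Nat.factorial_succ]; push_cast; ring
    have e1 : ((n + 1)! : ℚ) = (n + 1) * n ! := by
      rw [Nat.factorial_succ]; push_cast; ring
    have h := hypergeometricSum_add_two n
    rw [dualHahn_add_two, h0, h1, e2, e1]
    simp only [C_mul, C_add, C_pow] at h ⊢
    linear_combination -((C (n : ℚ) + C 1) * C (n ! : ℚ)) ^ 2 * h

theorem momentFunctional_dualHahn_zero : momentFunctional evenMoment (dualHahn 0) = 1 / 2 := by
  have := momentFunctional_centralFactorial 0
  simpa [centralFactorial, dualHahn] using this

/-- Each scaled central factorial has value `(-1)^k/2`, so the sum is a multiple of `(1 - 1)^(n+1)`.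
-/
theorem momentFunctional_dualHahn_succ (n : ℕ) :
    momentFunctional evenMoment (dualHahn (n + 1)) = 0 := by
  rw [dualHahn_eq, ← smul_eq_C_mul, map_smul, hypergeometricSum, map_sum]
  have e : ∀ k ∈ Finset.range (n + 1 + 1), momentFunctional evenMoment
      (C ((n + 1).choose k : ℚ) * scaledCentralFactorial k) =
        ((-1) ^ k * ((n + 1).choose k : ℚ)) * (1 / 2) := by
    intro k _
    rw [scaledCentralFactorial, ← smul_eq_C_mul, ← smul_eq_C_mul, map_smul, map_smul,
      momentFunctional_centralFactorial]
    have : (k ! : ℚ) ≠ 0 := by positivity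
    simp only [smul_eq_mul]
    field_simp
  have h := Int.alternating_sum_range_choose_of_ne (Nat.succ_ne_zero n)
  have h' : ∑ k ∈ Finset.range (n + 1 + 1), ((-1) ^ k * ((n + 1).choose k : ℚ)) = 0 := by
    exact_mod_cast h
  rw [Finset.sum_congr rfl e, ← Finset.sum_mul, h', zero_mul, smul_zero]

theorem X_mul_dualHahn_succ (n : ℕ) :
    X * dualHahn (n + 1) = dualHahn (n + 2) - (((n : ℚ) + 2) * (2 * n + 3)) • dualHahn (n + 1) +
      (((n : ℚ) + 1) ^ 3 * (n + 2)) • dualHahn n := by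
  rw [dualHahn_add_two, smul_eq_C_mul, smul_eq_C_mul]
  ring

/-- Each factor `X` is absorbed by the three-term recurrence. On the diagonal only the lowest term
survives, contributing `(n+1)^3 (n+2)` in the passage from `n` to `n + 1`. -/
theorem momentFunctional_X_pow_mul_dualHahn (i n : ℕ) (h : i ≤ n) :
    momentFunctional evenMoment (X ^ i * dualHahn n) =
      if i = n then (n ! : ℚ) ^ 3 * (n + 1)! / 2 else 0 := by
  induction i generalizing n with
  | zero =>
    rw [pow_zero, one_mul]
    rcases n with _ | n
    · simp [momentFunctional_dualHahn_zero]
    · simp [momentFunctional_dualHahn_succ]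
  | succ i ih =>
    obtain ⟨n, rfl⟩ : ∃ m, n = m + 1 := ⟨n - 1, by omega⟩
    rw [pow_succ, mul_assoc, X_mul_dualHahn_succ, mul_add, mul_sub, mul_smul_comm, mul_smul_comm,
      map_add, map_sub, map_smul, map_smul, ih _ (by omega), ih _ (by omega), ih _ (by omega),
      if_neg (by omega), if_neg (by omega)]
    by_cases hin : i = n
    · subst hin
      simp only [if_true, smul_eq_mul, mul_zero, sub_zero, zero_add, Nat.factorial_succ]
      push_cast
      ring
    · rw [if_neg hin, if_neg (by omega)]
      simp

/-- Since `M(X p_(n+1)) = L(p_(n+1)) = 0`, the numbers `M(p_n)` satisfy the recurrence of `dualHahn`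
at `X = 0`, but start from 0 and 1/2. -/
theorem momentFunctional_even_genocchi_dualHahn (n : ℕ) :
    momentFunctional (fun k => genocchiMoment (2 * k)) (dualHahn n) =
      (n ! : ℚ) ^ 2 * harmonic n / 2 := by
  have h0 := momentFunctional.apply_X_pow (fun k => genocchiMoment (2 * k)) 0
  have h1 := momentFunctional.apply_X_pow (fun k => genocchiMoment (2 * k)) 1
  induction n using Nat.twoStepInduction with
  | zero =>
    rw [pow_zero] at h0
    rw [dualHahn, h0]
    simp [genocchiMoment]
  | one =>
    rw [pow_zero] at h0
    rw [pow_one] at h1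
    rw [dualHahn, map_add, h0, h1]
    norm_num [genocchiMoment, bernoulli_two, harmonic]
  | more n ih0 ih1 =>
    have h := congrArg (momentFunctional fun k => genocchiMoment (2 * k)) (X_mul_dualHahn_succ n)
    rw [momentFunctional.apply_X_mul, momentFunctional_dualHahn_succ, map_add, map_sub, map_smul,
      map_smul, ih0, ih1] at h
    have e1 : harmonic (n + 1) = harmonic n + ((n : ℚ) + 1)⁻¹ := by
      rw [harmonic_succ]; push_cast; rfl
    have e2 : harmonic (n + 2) = harmonic n + ((n : ℚ) + 1)⁻¹ + ((n : ℚ) + 2)⁻¹ := by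
      rw [harmonic_succ, e1]; push_cast; ring
    have f1 : ((n + 1)! : ℚ) = (n + 1) * n ! := by
      rw [Nat.factorial_succ]; push_cast; ring
    have f2 : ((n + 2)! : ℚ) = (n + 2) * (n + 1) * n ! := by
      rw [Nat.factorial_succ, Nat.cast_mul, f1]; push_cast; ring
    rw [e1, f1] at h
    rw [e2, f2]
    simp only [smul_eq_mul] at h
    have hn1 : (n : ℚ) + 1 ≠ 0 := by positivity
    have hn2 : (n : ℚ) + 2 ≠ 0 := by positivity
    field_simp at h ⊢
    linear_combination -h

end OrthogonalPolynomials

/-! ### Evaluation of the two Hankel determinants -/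

theorem hankelDet_evenMoment_succ (n : ℕ) :
    hankelDet (n + 1) evenMoment =
      ((n + 1)! : ℚ) ^ 3 * (n + 2)! / 2 * hankelDet n evenMoment := by
  obtain ⟨hdeg, hlead⟩ := dualHahn_monic_natDegree (n + 1)
  rw [hankelDet_eq_of_moments (n + 1) evenMoment _ hdeg hlead (Fin.last _)
    (((n + 1)! : ℚ) ^ 3 * (n + 2)! / 2) fun i => by
      rw [momentFunctional_X_pow_mul_dualHahn _ _ (Nat.lt_succ_iff.mp i.2)]
      simp only [Fin.ext_iff, Fin.val_last]]
  rw [Fin.val_last, ← two_mul, pow_mul, neg_one_sq, one_pow, one_mul, Fin.succAbove_last]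
  rfl

/-- Here the surviving row is the first. Deleting it raises every index by one, which turns the
minor into a Hankel matrix of `evenMoment`. -/
theorem hankelDet_even_genocchi_succ (n : ℕ) :
    hankelDet (n + 1) (fun k => genocchiMoment (2 * k)) =
      (-1) ^ (n + 1) * (((n + 1)! : ℚ) ^ 2 * harmonic (n + 1) / 2) * hankelDet n evenMoment := by
  obtain ⟨hdeg, hlead⟩ := dualHahn_monic_natDegree (n + 1)
  rw [hankelDet_eq_of_moments (n + 1) _ _ hdeg hlead 0
    (((n + 1)! : ℚ) ^ 2 * harmonic (n + 1) / 2) fun i => ?_]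
  · rw [Fin.val_zero, zero_add]
    congr 2
    ext i j
    simp only [Matrix.of_apply, Fin.succAbove_zero, Fin.val_succ, evenMoment]
    congr 1
    omega
  · induction i using Fin.cases with
    | zero => simp [momentFunctional_even_genocchi_dualHahn]
    | succ i =>
      rw [if_neg (Fin.succ_ne_zero i), Fin.val_succ, pow_succ', mul_assoc,
        momentFunctional.apply_X_mul, momentFunctional_X_pow_mul_dualHahn _ _ i.2.le,
        if_neg i.2.ne]

theorem proposition3p4 (n : ℕ) (hn : 1 ≤ n) :
    hankelDet n (fun k : ℕ => ((2 : ℚ) ^ (2 * k) - 1) * bernoulli (2 * k)) =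
      (-1 : ℚ) ^ n / ((n ! : ℚ) * ((n + 1)! : ℚ)) * harmonic n *
        hankelDet n (fun k : ℕ => ((2 : ℚ) ^ (2 * k + 2) - 1) * bernoulli (2 * k + 2)) := by
  obtain ⟨m, rfl⟩ : ∃ m, n = m + 1 := ⟨n - 1, by omega⟩
  have h1 := hankelDet_even_genocchi_succ m
  have h2 := hankelDet_evenMoment_succ m
  change hankelDet (m + 1) (fun k => genocchiMoment (2 * k)) =
    _ * _ * hankelDet (m + 1) evenMoment
  rw [h1, h2]
  have f1 : ((m + 1)! : ℚ) ≠ 0 := by positivity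
  have f2 : ((m + 2)! : ℚ) ≠ 0 := by positivity
  rw [show m + 1 + 1 = m + 2 from rfl]
  field_simp
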